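/- Let $m,k\ge 1$, $n=m+k$, and write points of $\mathbb R^n=\mathbb R^m\times\mathbb R^k$ as $z=(Z_1,Z_2)$. Let $1<p<\infty$, let $\omega_1\subset\mathbb R^m$ be open, bounded and convex with $0\in\omega_1$, let $\omega_2\subset\mathbb R^k$ be nonempty, open and bounded, and put $\Omega_\ell=\ell\omega_1\times\omega_2$ for $\ell>0$. Let $1<q<\infty$, let $F:\mathbb R^m\to\mathbb R$ and $G:\mathbb R^k\to\mathbb R$ satisfy, for constants $0<\theta_1\le\theta_2$, $$\theta_1|Z_1|\le F(Z_1)\le\theta_2|Z_1|,\qquad \theta_1|Z_2|\le G(Z_2)\le\theta_2|Z_2|,$$ and suppose that $$H(z)=\tilde H_q(z)=\bigl(F^q(Z_1)+G^q(Z_2)\bigr)^{1/q}$$ is convex, positive on $\mathbb R^n\setminus\{0\}$, absolutely $1$-homogeneous ($H(tz)=|t|H(z)$ for all $t\in\mathbb R$) and of class $C^1$ on $\mathbb R^n\setminus\{0\}$. Let $$\lambda_\ell^1=\inf_{0\ne v\in W^{1,p}_0(\Omega_\ell)}\frac{\int_{\Omega_\ell}H^p(\nabla v)\,dx}{\int_{\Omega_\ell}|v|^p\,dx},\qquad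 \mu_\infty=\inf_{0\ne w\in W^{1,p}_0(\omega_2)}\frac{\int_{\omega_2}H^p(0,\nabla w)\,dX_2}{\int_{\omega_2}|w|^p\,dX_2}.$$ Then for every $\ell>0$: (i) if $q\le p$, then $\displaystyle \mu_\infty+\frac{C_1}{\ell^p}\le\lambda_\ell^1$; (ii) if $q\ge p$, then $\displaystyle \lambda_\ell^1\le\mu_\infty+\frac{C_2}{\ell^p}$, where $C_1>0$ depends only on $\theta_1,p$ and $\omega_1$ (and $m$), and $C_2>0$ depends only on $\theta_2,m,p$ and $\omega_1$; in particular, neither depends on $\ell$, $\omega_2$, $k$, $q$ or on $F,G$ otherwise. -/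

import Mathlib

open MeasureTheory Filter Topology
open scoped ContDiff Pointwise

noncomputable section

namespace FinslerCylinder

/-- A function `H : ℝ^ι → [0, ∞)` that is positive away from the origin, convex,
absolutely homogeneous of degree one, and `C¹` away from the origin. -/
structure IsFinsler {ι : Type*} [Fintype ι] (H : EuclideanSpace ℝ ι → ℝ) : Prop where
  nonneg : ∀ z, 0 ≤ H z
  pos : ∀ z, z ≠ 0 → 0 < H z
  convex : ConvexOn ℝ Set.univ H
  homogeneous : ∀ (t : ℝ) (z : EuclideanSpace ℝ ι), H (t • z) = |t| * H z
  contDiffOn : ContDiffOn ℝ 1 H {0}ᶜ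

/-- `φ ∈ C_c^∞(Ω)`. -/
structure IsTestFunction {ι : Type*} [Fintype ι] (Ω : Set (EuclideanSpace ℝ ι))
    (φ : EuclideanSpace ℝ ι → ℝ) : Prop where
  smooth : ContDiff ℝ ∞ φ
  compact : HasCompactSupport φ
  subset : tsupport φ ⊆ Ω

/-- `g` is the weak (distributional) gradient of `v` in `Ω`. -/
def HasWeakGradient {ι : Type*} [Fintype ι] (Ω : Set (EuclideanSpace ℝ ι))
    (v : EuclideanSpace ℝ ι → ℝ) (g : EuclideanSpace ℝ ι → EuclideanSpace ℝ ι) : Prop :=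
  ∀ φ : EuclideanSpace ℝ ι → ℝ, IsTestFunction Ω φ → ∀ i : ι,
    ∫ x in Ω, v x * (gradient φ x) i = -∫ x in Ω, (g x) i * φ x

/-- `v ∈ W^{1,p}(Ω)` with weak gradient `g`. -/
structure MemW1 {ι : Type*} [Fintype ι] (p : ℝ) (Ω : Set (EuclideanSpace ℝ ι))
    (v : EuclideanSpace ℝ ι → ℝ) (g : EuclideanSpace ℝ ι → EuclideanSpace ℝ ι) : Prop where
  memLp : MemLp v (ENNReal.ofReal p) (volume.restrict Ω)
  memLp_grad : MemLp g (ENNReal.ofReal p) (volume.restrict Ω)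
  weakGradient : HasWeakGradient Ω v g

/-- `v ∈ W^{1,p}_0(Ω)` with weak gradient `g`: the function `v` lies in `W^{1,p}(Ω)` and in the
closure of `C_c^∞(Ω)` for the norm of `W^{1,p}(Ω)`. -/
structure MemW10 {ι : Type*} [Fintype ι] (p : ℝ) (Ω : Set (EuclideanSpace ℝ ι))
    (v : EuclideanSpace ℝ ι → ℝ) (g : EuclideanSpace ℝ ι → EuclideanSpace ℝ ι) : Prop
    extends MemW1 p Ω v g where
  approx : ∃ φ : ℕ → EuclideanSpace ℝ ι → ℝ, (∀ j, IsTestFunction Ω (φ j)) ∧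
    Tendsto (fun j => eLpNorm (fun x => v x - φ j x) (ENNReal.ofReal p) (volume.restrict Ω))
      atTop (𝓝 0) ∧
    Tendsto (fun j => eLpNorm (fun x => g x - gradient (φ j) x) (ENNReal.ofReal p)
      (volume.restrict Ω)) atTop (𝓝 0)

/-- The values of the Rayleigh quotient `∫_Ω H(∇v)^p / ∫_Ω |v|^p` over all nonzero
`v ∈ W^{1,p}_0(Ω)`. -/
def rayleighValues {ι : Type*} [Fintype ι] (p : ℝ) (H : EuclideanSpace ℝ ι → ℝ)
    (Ω : Set (EuclideanSpace ℝ ι)) : Set ℝ :=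
  {t | ∃ v g, MemW10 p Ω v g ∧ ¬ (v =ᵐ[volume.restrict Ω] 0) ∧
    t = (∫ x in Ω, H (g x) ^ p) / ∫ x in Ω, |v x| ^ p}

/-- The least value of the Rayleigh quotient: the first eigenvalue of the Finsler `p`-Laplacian
in `Ω` with zero Dirichlet boundary values. -/
def firstEigenvalue {ι : Type*} [Fintype ι] (p : ℝ) (H : EuclideanSpace ℝ ι → ℝ)
    (Ω : Set (EuclideanSpace ℝ ι)) : ℝ :=
  sInf (rayleighValues p H Ω)

/-! The space `ℝⁿ`, `n = m + k`, is `EuclideanSpace ℝ (Fin m ⊕ Fin k)`, with points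
`x = (X₁, X₂)`, `X₁ ∈ ℝᵐ`, `X₂ ∈ ℝᵏ`. -/

/-- The component `X₁` of `x = (X₁, X₂)`. -/
def part₁ {m k : ℕ} (x : EuclideanSpace ℝ (Fin m ⊕ Fin k)) : EuclideanSpace ℝ (Fin m) :=
  WithLp.toLp 2 fun i => x (Sum.inl i)

/-- The component `X₂` of `x = (X₁, X₂)`. -/
def part₂ {m k : ℕ} (x : EuclideanSpace ℝ (Fin m ⊕ Fin k)) : EuclideanSpace ℝ (Fin k) :=
  WithLp.toLp 2 fun i => x (Sum.inr i)

/-- The point `(0, Z₂)` of `ℝⁿ`. -/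
def zeroPair (m : ℕ) {k : ℕ} (Z₂ : EuclideanSpace ℝ (Fin k)) :
    EuclideanSpace ℝ (Fin m ⊕ Fin k) :=
  WithLp.toLp 2 (Sum.elim (fun _ => 0) fun i => Z₂ i)

/-- The cylinder `Ω_ℓ = ℓω₁ × ω₂`. -/
def cylinder {m k : ℕ} (ω₁ : Set (EuclideanSpace ℝ (Fin m))) (ω₂ : Set (EuclideanSpace ℝ (Fin k)))
    (ℓ : ℝ) : Set (EuclideanSpace ℝ (Fin m ⊕ Fin k)) :=
  {x | part₁ x ∈ ℓ • ω₁ ∧ part₂ x ∈ ω₂}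

/-- `H̃_q(Z₁, Z₂) = (F(Z₁)^q + G(Z₂)^q)^{1/q}`. -/
def Htilde {m k : ℕ} (q : ℝ) (F : EuclideanSpace ℝ (Fin m) → ℝ)
    (G : EuclideanSpace ℝ (Fin k) → ℝ) (z : EuclideanSpace ℝ (Fin m ⊕ Fin k)) : ℝ :=
  (F (part₁ z) ^ q + G (part₂ z) ^ q) ^ (1 / q)

/-- `λ_ℓ¹`, the minimum of `∫_{Ω_ℓ} H(∇v)^p / ∫_{Ω_ℓ} |v|^p` over nonzero
`v ∈ W^{1,p}_0(Ω_ℓ)`. -/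
def lambda₁ {m k : ℕ} (p : ℝ) (H : EuclideanSpace ℝ (Fin m ⊕ Fin k) → ℝ)
    (ω₁ : Set (EuclideanSpace ℝ (Fin m))) (ω₂ : Set (EuclideanSpace ℝ (Fin k))) (ℓ : ℝ) : ℝ :=
  firstEigenvalue p H (cylinder ω₁ ω₂ ℓ)

/-- `μ_∞`, the minimum of `∫_{ω₂} H(0, ∇w)^p / ∫_{ω₂} |w|^p` over nonzero
`w ∈ W^{1,p}_0(ω₂)`. -/
def muInf {m k : ℕ} (p : ℝ) (H : EuclideanSpace ℝ (Fin m ⊕ Fin k) → ℝ)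
    (ω₂ : Set (EuclideanSpace ℝ (Fin k))) : ℝ :=
  firstEigenvalue p (fun Z₂ => H (zeroPair m Z₂)) ω₂

/-- `q ∈ (1, ∞)`, the functions `F` on `ℝᵐ` and `G` on `ℝᵏ` lie between `θ₁|·|` and `θ₂|·|`, and
`H̃_q` built from them is an admissible integrand on `ℝⁿ`. -/
structure Admissible {m k : ℕ} (θ₁ θ₂ q : ℝ) (F : EuclideanSpace ℝ (Fin m) → ℝ)
    (G : EuclideanSpace ℝ (Fin k) → ℝ) : Prop where
  one_lt : 1 < q
  F_bounds : ∀ Z, θ₁ * ‖Z‖ ≤ F Z ∧ F Z ≤ θ₂ * ‖Z‖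
  G_bounds : ∀ Z, θ₁ * ‖Z‖ ≤ G Z ∧ G Z ≤ θ₂ * ‖Z‖
  finsler : IsFinsler (Htilde q F G)

end FinslerCylinder

end

/-! Everything rests on comparing `Htilde ^ p` with `F ^ p + G ^ p`: by monotonicity of the ℓ^q
norms on the plane, the former dominates when q ≤ p and is dominated when p ≤ q. Since F vanishes at
0, `Htilde` restricted to vectors (0, Z₂) is G, so `muInf` is the first eigenvalue of G on ω₂.

Lower bound. For a test function φ on the cylinder, each slice with X₁ frozen is a test function on
ω₂, and Fubini bounds the G-energy below by `muInf` times the mass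
(`IsTestFunction.firstEigenvalue_mul_le_slice`). For the F-energy, F ≥ θ₁|∂ᵢφ| for one coordinate i
of ℝᵐ. If ω₁ lies in the ball of radius R, that coordinate is at most Rℓ in absolute value on the
cylinder, and a one-directional Poincaré inequality (`IsTestFunction.integral_abs_rpow_le`) yields
θ₁^p / (pRℓ)^p times the mass.

Upper bound. Fix a bump ψ on ω₁ and insert ψ(X₁/ℓ) w(X₂). The energy splits into the G-quotient of w
plus a term of order ℓ^(-p), because dilation divides the gradient of ψ by ℓ.

No minimizers are needed: bounds from below on an eigenvalue are checked on test functions and pass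
to the W₀^{1,p} closure (`le_firstEigenvalue`), the upper bound being read as a lower bound for
`muInf`. -/

namespace FinslerCylinder

/-! ### Finsler integrands are globally Lipschitz. -/

section Integrands

variable {ι : Type*} [Fintype ι] {H : EuclideanSpace ℝ ι → ℝ}

theorem IsFinsler.map_zero (h : IsFinsler H) : H 0 = 0 := by
  simpa using h.homogeneous 0 0

theorem IsFinsler.add_le (h : IsFinsler H) (x y : EuclideanSpace ℝ ι) : H (x + y) ≤ H x + H y := by
  have h1 := h.convex.2 (Set.mem_univ ((2 : ℝ) • x)) (Set.mem_univ ((2 : ℝ) • y))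
    (by norm_num : (0 : ℝ) ≤ 1 / 2) (by norm_num : (0 : ℝ) ≤ 1 / 2) (by norm_num)
  rw [smul_smul, smul_smul, h.homogeneous, h.homogeneous] at h1
  norm_num at h1
  linarith

/-- A convex function in finite dimension is Lipschitz near 0; homogeneity shrinks any x into that
neighbourhood and the scale factor cancels. -/
theorem IsFinsler.exists_bound (h : IsFinsler H) : ∃ K : NNReal, ∀ x, H x ≤ K * ‖x‖ := by
  obtain ⟨K, t, ht, hK⟩ := h.convex.locallyLipschitz 0
  refine ⟨K, fun x => ?_⟩
  have hlim : Tendsto (fun c : ℝ => c • x) (𝓝[>] 0) (𝓝 0) := by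
    have : Continuous fun c : ℝ => c • x := by fun_prop
    simpa using (this.tendsto 0).mono_left nhdsWithin_le_nhds
  obtain ⟨c, hct, hc⟩ := ((hlim.eventually ht).and self_mem_nhdsWithin).exists
  have hc : 0 < c := hc
  have h1 := hK.dist_le_mul _ hct _ (mem_of_mem_nhds ht)
  rw [h.map_zero, dist_zero_right, dist_zero_right, h.homogeneous, norm_smul, Real.norm_eq_abs,
    Real.norm_eq_abs, abs_mul, abs_abs, abs_of_pos hc, abs_of_nonneg (h.nonneg x)] at h1
  nlinarith

theorem IsFinsler.exists_lipschitzWith (h : IsFinsler H) : ∃ K : NNReal, LipschitzWith K H := by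
  obtain ⟨K, hK⟩ := h.exists_bound
  refine ⟨K, LipschitzWith.of_le_add_mul K fun x y => ?_⟩
  have h1 := h.add_le y (x - y)
  rw [add_sub_cancel] at h1
  rw [dist_eq_norm]
  linarith [hK (x - y)]

end Integrands

/-! ### Continuity of p-th power integrals under L^p convergence. -/

section Lp

variable {α E : Type*} [MeasurableSpace α] {μ : Measure α} [NormedAddCommGroup E]

theorem integral_norm_rpow_eq_eLpNorm {p : ℝ} (hp : 0 < p) {f : α → E}
    (hf : MemLp f (ENNReal.ofReal p) μ) :
    ∫ x, ‖f x‖ ^ p ∂μ = (eLpNorm f (ENNReal.ofReal p) μ).toReal ^ p := by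
  have h0 : 0 ≤ ∫ x, ‖f x‖ ^ p ∂μ := integral_nonneg fun x => by positivity
  rw [hf.eLpNorm_eq_integral_rpow_norm (by simpa using hp) ENNReal.ofReal_ne_top,
    ENNReal.toReal_ofReal hp.le, ENNReal.toReal_ofReal (by positivity),
    Real.rpow_inv_rpow h0 hp.ne']

theorem tendsto_integral_norm_rpow {p : ℝ} (hp : 1 ≤ p) {f : α → E} {u : ℕ → α → E}
    (hf : MemLp f (ENNReal.ofReal p) μ) (hu : ∀ j, MemLp (u j) (ENNReal.ofReal p) μ)
    (h : Tendsto (fun j => eLpNorm (fun x => f x - u j x) (ENNReal.ofReal p) μ) atTop (𝓝 0)) :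
    Tendsto (fun j => ∫ x, ‖u j x‖ ^ p ∂μ) atTop (𝓝 (∫ x, ‖f x‖ ^ p ∂μ)) := by
  have hp0 : 0 < p := by linarith
  have : Fact (1 ≤ ENNReal.ofReal p) := ⟨by simpa using hp⟩
  have h' : Tendsto (fun j => eLpNorm (u j - f) (ENNReal.ofReal p) μ) atTop (𝓝 0) := by
    refine h.congr fun j => ?_
    rw [eLpNorm_sub_comm]
    rfl
  have h1 := ((Lp.tendsto_Lp_iff_tendsto_eLpNorm'' u hu f hf).2 h').norm
  simp only [Lp.norm_toLp] at h1
  simp only [integral_norm_rpow_eq_eLpNorm hp0 hf, fun j => integral_norm_rpow_eq_eLpNorm hp0 (hu j)]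
  exact h1.rpow_const (Or.inr hp0.le)

end Lp

/-! ### Calculus and integrability of test functions. -/

section TestFunctions

variable {ι : Type*} [Fintype ι] {Ω : Set (EuclideanSpace ℝ ι)} {φ : EuclideanSpace ℝ ι → ℝ}

theorem gradient_apply (φ : EuclideanSpace ℝ ι → ℝ) (x : EuclideanSpace ℝ ι) [DecidableEq ι]
    (i : ι) : gradient φ x i = fderiv ℝ φ x (EuclideanSpace.single i 1) := by
  rw [← inner_gradient_left, EuclideanSpace.inner_single_right]
  simp

theorem IsTestFunction.continuous (h : IsTestFunction Ω φ) : Continuous φ := h.smooth.continuous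

theorem IsTestFunction.differentiable (h : IsTestFunction Ω φ) : Differentiable ℝ φ :=
  h.smooth.differentiable (by simp)

theorem IsTestFunction.continuous_fderiv (h : IsTestFunction Ω φ) : Continuous (fderiv ℝ φ) :=
  h.smooth.continuous_fderiv (by simp)

theorem IsTestFunction.continuous_gradient (h : IsTestFunction Ω φ) : Continuous (gradient φ) :=
  (InnerProductSpace.toDual ℝ (EuclideanSpace ℝ ι)).symm.continuous.comp h.continuous_fderiv

theorem gradient_of_notMem_tsupport {x : EuclideanSpace ℝ ι} (hx : x ∉ tsupport φ) :
    gradient φ x = 0 := by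
  rw [gradient, fderiv_of_notMem_tsupport ℝ hx, map_zero]

theorem IsTestFunction.hasCompactSupport_gradient (h : IsTestFunction Ω φ) :
    HasCompactSupport (gradient φ) :=
  HasCompactSupport.intro h.compact fun _ hx => gradient_of_notMem_tsupport hx

theorem IsTestFunction.eq_zero (h : IsTestFunction Ω φ) {x : EuclideanSpace ℝ ι} (hx : x ∉ Ω) :
    φ x = 0 :=
  image_eq_zero_of_notMem_tsupport fun h' => hx (h.subset h')

theorem IsTestFunction.gradient_eq_zero (h : IsTestFunction Ω φ) {x : EuclideanSpace ℝ ι}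
    (hx : x ∉ Ω) : gradient φ x = 0 :=
  gradient_of_notMem_tsupport fun h' => hx (h.subset h')

theorem IsTestFunction.continuous_abs_rpow (h : IsTestFunction Ω φ) {p : ℝ} (hp : 0 < p) :
    Continuous fun x => |φ x| ^ p :=
  h.continuous.abs.rpow_const fun _ => Or.inr hp.le

theorem IsTestFunction.hasCompactSupport_abs_rpow (h : IsTestFunction Ω φ) {p : ℝ} (hp : 0 < p) :
    HasCompactSupport fun x => |φ x| ^ p :=
  h.compact.comp_left (g := fun t => |t| ^ p) (by simp [hp.ne'])

theorem IsTestFunction.integrable_abs_rpow (h : IsTestFunction Ω φ) {p : ℝ} (hp : 0 < p) :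
    Integrable fun x => |φ x| ^ p :=
  (h.continuous_abs_rpow hp).integrable_of_hasCompactSupport (h.hasCompactSupport_abs_rpow hp)

theorem IsTestFunction.continuous_energy (h : IsTestFunction Ω φ) {p : ℝ} (hp : 0 < p)
    {N : EuclideanSpace ℝ ι → ℝ} (hN : Continuous N) : Continuous fun x => N (gradient φ x) ^ p :=
  (hN.comp h.continuous_gradient).rpow_const fun _ => Or.inr hp.le

theorem IsTestFunction.hasCompactSupport_energy (h : IsTestFunction Ω φ) {p : ℝ} (hp : 0 < p)
    {N : EuclideanSpace ℝ ι → ℝ} (hN0 : N 0 = 0) :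
    HasCompactSupport fun x => N (gradient φ x) ^ p :=
  h.hasCompactSupport_gradient.comp_left (g := fun z => N z ^ p) (by simp [hN0, hp.ne'])

theorem IsTestFunction.integrable_energy (h : IsTestFunction Ω φ) {p : ℝ} (hp : 0 < p)
    {N : EuclideanSpace ℝ ι → ℝ} (hN : Continuous N) (hN0 : N 0 = 0) :
    Integrable fun x => N (gradient φ x) ^ p :=
  (h.continuous_energy hp hN).integrable_of_hasCompactSupport (h.hasCompactSupport_energy hp hN0)

theorem IsTestFunction.setIntegral_abs_rpow (h : IsTestFunction Ω φ) {p : ℝ} (hp : 0 < p) :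
    ∫ x in Ω, |φ x| ^ p = ∫ x, |φ x| ^ p :=
  setIntegral_eq_integral_of_forall_compl_eq_zero fun x hx => by simp [h.eq_zero hx, hp.ne']

theorem IsTestFunction.setIntegral_energy (h : IsTestFunction Ω φ) {p : ℝ} (hp : 0 < p)
    {N : EuclideanSpace ℝ ι → ℝ} (hN0 : N 0 = 0) :
    ∫ x in Ω, N (gradient φ x) ^ p = ∫ x, N (gradient φ x) ^ p :=
  setIntegral_eq_integral_of_forall_compl_eq_zero fun x hx => by
    simp [h.gradient_eq_zero hx, hN0, hp.ne']

theorem IsTestFunction.memLp (h : IsTestFunction Ω φ) (p : ENNReal) :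
    MemLp φ p (volume.restrict Ω) :=
  (h.continuous.memLp_of_hasCompactSupport h.compact).restrict Ω

theorem IsTestFunction.memLp_gradient (h : IsTestFunction Ω φ) (p : ENNReal) :
    MemLp (gradient φ) p (volume.restrict Ω) :=
  (h.continuous_gradient.memLp_of_hasCompactSupport h.hasCompactSupport_gradient).restrict Ω

theorem IsTestFunction.hasWeakGradient (h : IsTestFunction Ω φ) :
    HasWeakGradient Ω φ (gradient φ) := by
  classical
  intro ψ hψ i
  rw [setIntegral_eq_integral_of_forall_compl_eq_zero fun x hx => by simp [h.eq_zero hx],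
    setIntegral_eq_integral_of_forall_compl_eq_zero fun x hx => by simp [hψ.eq_zero hx]]
  simp only [gradient_apply]
  have hφ' : Continuous fun x => fderiv ℝ φ x (EuclideanSpace.single i 1) :=
    h.continuous_fderiv.clm_apply continuous_const
  have hψ' : Continuous fun x => fderiv ℝ ψ x (EuclideanSpace.single i 1) :=
    hψ.continuous_fderiv.clm_apply continuous_const
  exact integral_mul_fderiv_eq_neg_fderiv_mul_of_integrable
    ((hφ'.mul hψ.continuous).integrable_of_hasCompactSupport hψ.compact.mul_left)
    ((h.continuous.mul hψ').integrable_of_hasCompactSupport h.compact.mul_right)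
    ((h.continuous.mul hψ.continuous).integrable_of_hasCompactSupport h.compact.mul_right)
    (fun x _ => h.differentiable x) (fun x _ => hψ.differentiable x)

theorem IsTestFunction.memW10 (h : IsTestFunction Ω φ) (p : ℝ) :
    MemW10 p Ω φ (gradient φ) where
  memLp := h.memLp _
  memLp_grad := h.memLp_gradient _
  weakGradient := h.hasWeakGradient
  approx := ⟨fun _ => φ, fun _ => h, by simp, by simp⟩

theorem exists_isTestFunction_integral_pos (hΩ : IsOpen Ω) (hne : Ω.Nonempty) {p : ℝ}
    (hp : 0 < p) : ∃ φ, IsTestFunction Ω φ ∧ 0 < ∫ x, |φ x| ^ p := by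
  obtain ⟨x, hx⟩ := hne
  obtain ⟨f, hsub, hcomp, hsmooth, -, hfx⟩ :=
    exists_contDiff_tsupport_subset (n := ⊤) (hΩ.mem_nhds hx)
  have hf : IsTestFunction Ω f := ⟨hsmooth, hcomp, hsub⟩
  refine ⟨f, hf, (hf.continuous_abs_rpow hp).integral_pos_of_hasCompactSupport_nonneg_nonzero
    (hf.hasCompactSupport_abs_rpow hp) (fun y => by positivity) (x := x) (by simp [hfx])⟩

end TestFunctions

/-! ### Rayleigh quotients, reduction to test functions, Poincaré's inequality. -/

section Rayleigh

variable {ι : Type*} [Fintype ι] {Ω : Set (EuclideanSpace ℝ ι)} {H : EuclideanSpace ℝ ι → ℝ}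
  {p c : ℝ} {K : NNReal}

theorem bddBelow_rayleighValues (hH : ∀ z, 0 ≤ H z) : BddBelow (rayleighValues p H Ω) := by
  refine ⟨0, ?_⟩
  rintro t ⟨v, g, -, -, rfl⟩
  exact div_nonneg (integral_nonneg fun x => Real.rpow_nonneg (hH _) _)
    (integral_nonneg fun x => by positivity)

theorem integral_abs_rpow_pos (hp : 0 < p) {v : EuclideanSpace ℝ ι → ℝ}
    (hv : MemLp v (ENNReal.ofReal p) (volume.restrict Ω)) (hne : ¬ v =ᵐ[volume.restrict Ω] 0) :
    0 < ∫ x in Ω, |v x| ^ p := by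
  have h := integral_norm_rpow_eq_eLpNorm hp hv
  simp only [Real.norm_eq_abs] at h
  rw [h]
  refine Real.rpow_pos_of_pos (ENNReal.toReal_pos (fun h0 => hne ?_) hv.eLpNorm_ne_top) _
  exact (eLpNorm_eq_zero_iff hv.1 (by simpa using hp)).1 h0

/-- Density: since H is Lipschitz and vanishes at 0, L^p convergence of gradients gives L^p
convergence of H of the gradients, so both sides pass to the limit. -/
theorem MemW10.mul_integral_le (hp : 1 < p) (hH : ∀ z, 0 ≤ H z) (hL : LipschitzWith K H)
    (hH0 : H 0 = 0)
    (hc : ∀ φ, IsTestFunction Ω φ → c * ∫ x, |φ x| ^ p ≤ ∫ x, H (gradient φ x) ^ p)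
    {v : EuclideanSpace ℝ ι → ℝ} {g : EuclideanSpace ℝ ι → EuclideanSpace ℝ ι}
    (hv : MemW10 p Ω v g) : c * ∫ x in Ω, |v x| ^ p ≤ ∫ x in Ω, H (g x) ^ p := by
  have hp0 : 0 < p := by linarith
  obtain ⟨φ, hφ, h1, h2⟩ := hv.approx
  have hcomp : ∀ {u : EuclideanSpace ℝ ι → EuclideanSpace ℝ ι},
      MemLp u (ENNReal.ofReal p) (volume.restrict Ω) →
      MemLp (fun x => H (u x)) (ENNReal.ofReal p) (volume.restrict Ω) :=
    fun hu => hL.comp_memLp hH0 hu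
  have h3 : Tendsto (fun j => eLpNorm (fun x => H (g x) - H (gradient (φ j) x))
      (ENNReal.ofReal p) (volume.restrict Ω)) atTop (𝓝 0) := by
    have hK : Tendsto (fun j => ENNReal.ofReal K * eLpNorm (fun x => g x - gradient (φ j) x)
        (ENNReal.ofReal p) (volume.restrict Ω)) atTop (𝓝 0) := by
      simpa only [mul_zero] using
        ENNReal.Tendsto.const_mul (a := ENNReal.ofReal K) h2 (Or.inr ENNReal.ofReal_ne_top)
    refine tendsto_of_tendsto_of_tendsto_of_le_of_le tendsto_const_nhds hK (fun _ => zero_le)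
      fun j => eLpNorm_le_mul_eLpNorm_of_ae_le_mul (ae_of_all _ fun x => ?_) _
    exact hL.norm_sub_le _ _
  have h4 := tendsto_integral_norm_rpow hp.le hv.memLp (fun j => (hφ j).memLp _) h1
  have h5 := tendsto_integral_norm_rpow hp.le (hcomp hv.memLp_grad)
    (fun j => hcomp ((hφ j).memLp_gradient _)) h3
  simp only [Real.norm_eq_abs, abs_of_nonneg (hH _)] at h4 h5
  refine le_of_tendsto_of_tendsto' (h4.const_mul c) h5 fun j => ?_
  rw [(hφ j).setIntegral_abs_rpow hp0, (hφ j).setIntegral_energy hp0 hH0]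
  exact hc _ (hφ j)

theorem IsTestFunction.firstEigenvalue_mul_le (hp : 0 < p) (hH : ∀ z, 0 ≤ H z) (hH0 : H 0 = 0)
    {φ : EuclideanSpace ℝ ι → ℝ} (hφ : IsTestFunction Ω φ) :
    firstEigenvalue p H Ω * ∫ x, |φ x| ^ p ≤ ∫ x, H (gradient φ x) ^ p := by
  rw [← hφ.setIntegral_abs_rpow hp, ← hφ.setIntegral_energy hp hH0]
  by_cases h0 : φ =ᵐ[volume.restrict Ω] 0
  · have : ∫ x in Ω, |φ x| ^ p = 0 := by
      rw [← integral_zero (EuclideanSpace ℝ ι) ℝ (μ := volume.restrict Ω)]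
      refine integral_congr_ae (h0.mono fun x hx => ?_)
      simp [hx, hp.ne']
    rw [this, mul_zero]
    exact integral_nonneg fun x => Real.rpow_nonneg (hH _) _
  · rw [← le_div_iff₀ (integral_abs_rpow_pos hp (hφ.memLp _) h0)]
    exact csInf_le (bddBelow_rayleighValues hH) ⟨φ, gradient φ, hφ.memW10 p, h0, rfl⟩

theorem rayleighValues_nonempty (hp : 0 < p) (hΩ : IsOpen Ω) (hne : Ω.Nonempty) :
    (rayleighValues p H Ω).Nonempty := by
  obtain ⟨φ, hφ, hpos⟩ := exists_isTestFunction_integral_pos hΩ hne hp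
  refine ⟨_, φ, gradient φ, hφ.memW10 p, fun h0 => hpos.ne' ?_, rfl⟩
  rw [← hφ.setIntegral_abs_rpow hp, ← integral_zero (EuclideanSpace ℝ ι) ℝ (μ := volume.restrict Ω)]
  refine integral_congr_ae (h0.mono fun x hx => ?_)
  simp [hx, hp.ne']

/-- A lower bound for the first eigenvalue may be verified on test functions. -/
theorem le_firstEigenvalue (hp : 1 < p) (hΩ : IsOpen Ω) (hne : Ω.Nonempty) (hH : ∀ z, 0 ≤ H z)
    (hL : LipschitzWith K H) (hH0 : H 0 = 0)
    (hc : ∀ φ, IsTestFunction Ω φ → c * ∫ x, |φ x| ^ p ≤ ∫ x, H (gradient φ x) ^ p) :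
    c ≤ firstEigenvalue p H Ω := by
  have hp0 : 0 < p := by linarith
  refine le_csInf (rayleighValues_nonempty hp0 hΩ hne) ?_
  rintro t ⟨v, g, hv, hv0, rfl⟩
  rw [le_div_iff₀ (integral_abs_rpow_pos hp0 hv.memLp hv0)]
  exact hv.mul_integral_le hp hH hL hH0 hc

/-- **Poincaré's inequality** for functions supported where one coordinate is bounded. -/
theorem IsTestFunction.integral_abs_rpow_le {φ : EuclideanSpace ℝ ι → ℝ}
    (hφ : IsTestFunction Ω φ) (hp : 1 < p) (i : ι) {R : ℝ} (hR : ∀ x ∈ Ω, |x i| ≤ R) :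
    ∫ x, |φ x| ^ p ≤ (p * R) ^ p * ∫ x, |gradient φ x i| ^ p := by
  classical
  have hp0 : 0 < p := by linarith
  set e : EuclideanSpace ℝ ι := EuclideanSpace.single i 1
  set D : EuclideanSpace ℝ ι → ℝ := fun x => fderiv ℝ φ x e
  have hD : Continuous D := hφ.continuous_fderiv.clm_apply continuous_const
  have hderiv : ∀ x, HasFDerivAt (fun x => |φ x| ^ p)
      ((p * |φ x| ^ (p - 2) * φ x) • fderiv ℝ φ x) x := fun x =>
    (hasDerivAt_abs_rpow (φ x) hp).comp_hasFDerivAt x (hφ.differentiable x).hasFDerivAt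
  have hC1 : ContDiff ℝ 1 fun x => |φ x| ^ p := by
    simpa only [Real.norm_eq_abs] using (hφ.smooth.of_le (by simp)).norm_rpow hp
  have hE : Continuous fun x => fderiv ℝ (fun x => |φ x| ^ p) x e :=
    (hC1.continuous_fderiv one_ne_zero).clm_apply continuous_const
  have hcs := hφ.hasCompactSupport_abs_rpow hp0
  have hEcs : HasCompactSupport fun x => fderiv ℝ (fun x => |φ x| ^ p) x e :=
    hcs.fderiv_apply ℝ e
  have hcoord : ∀ x : EuclideanSpace ℝ ι, fderiv ℝ (fun y : EuclideanSpace ℝ ι => y i) x e = 1 := by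
    intro x
    have : HasFDerivAt (fun y : EuclideanSpace ℝ ι => y i)
      (EuclideanSpace.proj i : EuclideanSpace ℝ ι →L[ℝ] ℝ) x :=
      (EuclideanSpace.proj i : EuclideanSpace ℝ ι →L[ℝ] ℝ).hasFDerivAt
    rw [this.fderiv]
    simp [e]
  have hci : Continuous fun y : EuclideanSpace ℝ ι => y i := by fun_prop
  -- As ∂ᵢxᵢ = 1, integration by parts turns ∫|φ|^p into -∫ xᵢ ∂ᵢ(|φ|^p).
  have hparts := integral_mul_fderiv_eq_neg_fderiv_mul_of_integrable (μ := volume)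
    (f := fun y : EuclideanSpace ℝ ι => y i) (g := fun x => |φ x| ^ p) (v := e)
    (by simpa only [hcoord, one_mul] using hφ.integrable_abs_rpow hp0)
    ((hci.mul hE).integrable_of_hasCompactSupport hEcs.mul_left)
    ((hci.mul (hφ.continuous_abs_rpow hp0)).integrable_of_hasCompactSupport hcs.mul_left)
    (fun x _ => by fun_prop) (fun x _ => (hderiv x).differentiableAt)
  simp only [hcoord, one_mul] at hparts
  have hDint : Integrable fun x => |D x| ^ p := by
    have hDcs : HasCompactSupport D := hφ.compact.fderiv_apply ℝ e
    exact (hD.abs.rpow_const fun _ => Or.inr hp0.le).integrable_of_hasCompactSupport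
      (hDcs.comp_left (g := fun t => |t| ^ p) (by simp [hp0.ne']))
  have hpq : (Real.conjExponent p).HolderConjugate p :=
    (Real.HolderConjugate.conjExponent hp).symm
  have hq : (Real.conjExponent p)⁻¹ = 1 - p⁻¹ := by
    have := hpq.inv_add_inv_eq_one
    linarith
  have hpoint : ∀ x, -(x i * fderiv ℝ (fun x => |φ x| ^ p) x e) ≤
      (1 - p⁻¹) * |φ x| ^ p + p⁻¹ * ((p * R) ^ p * |D x| ^ p) := by
    intro x
    by_cases hx : x ∈ Ω
    · have hR0 : 0 ≤ R := (abs_nonneg _).trans (hR x hx)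
      rw [(hderiv x).fderiv]
      -- Putting all of pR on the derivative leaves |φ|^p with coefficient 1 - 1/p < 1, which the
      -- left side can absorb.
      have hy := Real.young_inequality_of_nonneg (a := |φ x| ^ (p - 1)) (b := p * R * |D x|)
        (by positivity) (by positivity) hpq
      have e1 : (|φ x| ^ (p - 1)) ^ Real.conjExponent p = |φ x| ^ p := by
        rw [← Real.rpow_mul (abs_nonneg _), Real.conjExponent,
          mul_div_cancel₀ _ (by linarith : p - 1 ≠ 0)]
      rw [e1, Real.mul_rpow (by positivity) (abs_nonneg _), div_eq_inv_mul, div_eq_inv_mul, hq] at hy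
      refine le_trans ?_ hy
      -- The exponent p - 2 may be negative, so zeros of φ are treated apart.
      have e2 : |φ x| ^ (p - 2) * |φ x| = |φ x| ^ (p - 1) := by
        rcases (abs_nonneg (φ x)).eq_or_lt with h0 | h0
        · rw [← h0, mul_zero, Real.zero_rpow (by linarith)]
        · rw [← Real.rpow_add_one h0.ne']
          congr 1
          ring
      refine (neg_le_abs _).trans ?_
      rw [_root_.smul_apply, smul_eq_mul, abs_mul, abs_mul, abs_mul, abs_mul,
        abs_of_pos hp0, abs_of_nonneg (by positivity : 0 ≤ |φ x| ^ (p - 2)), mul_assoc p, e2]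
      calc |x i| * (p * |φ x| ^ (p - 1) * |D x|) ≤ R * (p * |φ x| ^ (p - 1) * |D x|) := by
            gcongr
            exact hR x hx
        _ = _ := by ring
    · have hx' : x ∉ tsupport φ := fun h => hx (hφ.subset h)
      have h1 : φ x = 0 := hφ.eq_zero hx
      have h2 : D x = 0 := by simp [D, fderiv_of_notMem_tsupport ℝ hx']
      rw [(hderiv x).fderiv]
      simp [h1, h2, hp0.ne']
  have hI := hφ.integrable_abs_rpow hp0
  have key : ∫ x, |φ x| ^ p ≤
      (1 - p⁻¹) * (∫ x, |φ x| ^ p) + p⁻¹ * ((p * R) ^ p * ∫ x, |D x| ^ p) := by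
    calc ∫ x, |φ x| ^ p = ∫ x, -(x i * fderiv ℝ (fun x => |φ x| ^ p) x e) := by
          rw [integral_neg, hparts, neg_neg]
      _ ≤ ∫ x, ((1 - p⁻¹) * |φ x| ^ p + p⁻¹ * ((p * R) ^ p * |D x| ^ p)) :=
          integral_mono ((hci.mul hE).integrable_of_hasCompactSupport hEcs.mul_left).neg
            ((hI.const_mul _).add ((hDint.const_mul _).const_mul _)) hpoint
      _ = _ := by
          rw [integral_add (hI.const_mul _) ((hDint.const_mul _).const_mul _),
            integral_const_mul, integral_const_mul, integral_const_mul]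
  simp only [gradient_apply]
  -- After absorption both sides carry the factor 1/p, which cancels.
  have hpinv : 0 < p⁻¹ := by positivity
  refine le_of_mul_le_mul_left ?_ hpinv
  linarith

end Rayleigh

end FinslerCylinder

namespace FinslerCylinder

/-! ### The splitting ℝⁿ = ℝᵐ × ℝᵏ: gradients, measure, slices and tensor products. -/

section Product

variable {m k : ℕ}

/-- The point `(X₁, X₂)` of `ℝⁿ`. -/
noncomputable def pair (a : EuclideanSpace ℝ (Fin m)) (b : EuclideanSpace ℝ (Fin k)) :
    EuclideanSpace ℝ (Fin m ⊕ Fin k) :=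
  (EuclideanSpace.sumEquivProd (𝕜 := ℝ) (ι := Fin m) (κ := Fin k)).symm (a, b)

/-- The embedding `X₁ ↦ (X₁, 0)`. -/
noncomputable def inlL (m k : ℕ) :
    EuclideanSpace ℝ (Fin m) →L[ℝ] EuclideanSpace ℝ (Fin m ⊕ Fin k) :=
  (EuclideanSpace.sumEquivProd (𝕜 := ℝ) (ι := Fin m) (κ := Fin k)).symm.toContinuousLinearMap ∘L
    ContinuousLinearMap.inl ℝ _ _

/-- The embedding `X₂ ↦ (0, X₂)`. -/
noncomputable def inrL (m k : ℕ) :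
    EuclideanSpace ℝ (Fin k) →L[ℝ] EuclideanSpace ℝ (Fin m ⊕ Fin k) :=
  (EuclideanSpace.sumEquivProd (𝕜 := ℝ) (ι := Fin m) (κ := Fin k)).symm.toContinuousLinearMap ∘L
    ContinuousLinearMap.inr ℝ _ _

/-- The projection `part₁` as a continuous linear map. -/
noncomputable def part₁L (m k : ℕ) :
    EuclideanSpace ℝ (Fin m ⊕ Fin k) →L[ℝ] EuclideanSpace ℝ (Fin m) :=
  ContinuousLinearMap.fst ℝ _ _ ∘L
    (EuclideanSpace.sumEquivProd (𝕜 := ℝ) (ι := Fin m) (κ := Fin k)).toContinuousLinearMap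

/-- The projection `part₂` as a continuous linear map. -/
noncomputable def part₂L (m k : ℕ) :
    EuclideanSpace ℝ (Fin m ⊕ Fin k) →L[ℝ] EuclideanSpace ℝ (Fin k) :=
  ContinuousLinearMap.snd ℝ _ _ ∘L
    (EuclideanSpace.sumEquivProd (𝕜 := ℝ) (ι := Fin m) (κ := Fin k)).toContinuousLinearMap

theorem contDiff_part₁ {n : WithTop ℕ∞} :
    ContDiff ℝ n (part₁ : EuclideanSpace ℝ (Fin m ⊕ Fin k) → _) :=
  (part₁L m k).contDiff

theorem contDiff_part₂ {n : WithTop ℕ∞} :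
    ContDiff ℝ n (part₂ : EuclideanSpace ℝ (Fin m ⊕ Fin k) → _) :=
  (part₂L m k).contDiff

theorem continuous_part₁ : Continuous (part₁ : EuclideanSpace ℝ (Fin m ⊕ Fin k) → _) :=
  (part₁L m k).continuous

theorem continuous_part₂ : Continuous (part₂ : EuclideanSpace ℝ (Fin m ⊕ Fin k) → _) :=
  (part₂L m k).continuous

theorem inrL_apply (b : EuclideanSpace ℝ (Fin k)) : inrL m k b = zeroPair m b := rfl

@[simp]
theorem part₁_pair (a : EuclideanSpace ℝ (Fin m)) (b : EuclideanSpace ℝ (Fin k)) :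
    part₁ (pair a b) = a := rfl

@[simp]
theorem part₂_pair (a : EuclideanSpace ℝ (Fin m)) (b : EuclideanSpace ℝ (Fin k)) :
    part₂ (pair a b) = b := rfl

@[simp]
theorem part₁_zeroPair (b : EuclideanSpace ℝ (Fin k)) : part₁ (zeroPair m b) = 0 := rfl

@[simp]
theorem part₂_zeroPair (b : EuclideanSpace ℝ (Fin k)) : part₂ (zeroPair m b) = b := rfl

theorem pair_part (x : EuclideanSpace ℝ (Fin m ⊕ Fin k)) : pair (part₁ x) (part₂ x) = x :=
  (EuclideanSpace.sumEquivProd (𝕜 := ℝ) (ι := Fin m) (κ := Fin k)).symm_apply_apply x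

theorem pair_eq_add (a : EuclideanSpace ℝ (Fin m)) (b : EuclideanSpace ℝ (Fin k)) :
    pair a b = inlL m k a + inrL m k b := by
  change EuclideanSpace.sumEquivProd.symm (a, b) =
    EuclideanSpace.sumEquivProd.symm (a, 0) + EuclideanSpace.sumEquivProd.symm (0, b)
  rw [← map_add, Prod.mk_add_mk, add_zero, zero_add]

theorem contDiff_pair {n : WithTop ℕ∞} :
    ContDiff ℝ n fun z : EuclideanSpace ℝ (Fin m) × EuclideanSpace ℝ (Fin k) => pair z.1 z.2 :=
  (EuclideanSpace.sumEquivProd (𝕜 := ℝ) (ι := Fin m) (κ := Fin k)).symm.contDiff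

theorem hasFDerivAt_pair_left (a : EuclideanSpace ℝ (Fin m)) (b : EuclideanSpace ℝ (Fin k)) :
    HasFDerivAt (fun y => pair y b) (inlL m k) a := by
  simpa only [pair_eq_add] using (inlL m k).hasFDerivAt.add_const (inrL m k b)

theorem hasFDerivAt_pair_right (a : EuclideanSpace ℝ (Fin m)) (b : EuclideanSpace ℝ (Fin k)) :
    HasFDerivAt (fun y => pair a y) (inrL m k) b := by
  simpa only [pair_eq_add] using (inrL m k).hasFDerivAt.const_add (inlL m k a)

theorem inlL_single (i : Fin m) :
    inlL m k (EuclideanSpace.single i 1) = EuclideanSpace.single (Sum.inl i) 1 := by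
  ext j
  rcases j with j | j
  · exact (PiLp.single_apply 2 ℝ i (1 : ℝ) j).trans
      ((PiLp.single_apply 2 ℝ (Sum.inl i : Fin m ⊕ Fin k) (1 : ℝ) (Sum.inl j)).trans
        (by simp)).symm
  · exact ((PiLp.single_apply 2 ℝ (Sum.inl i : Fin m ⊕ Fin k) (1 : ℝ) (Sum.inr j)).trans
      (by simp : _ = (0 : ℝ))).symm

theorem inrL_single (i : Fin k) :
    inrL m k (EuclideanSpace.single i 1) = EuclideanSpace.single (Sum.inr i) 1 := by
  ext j
  rcases j with j | j
  · exact ((PiLp.single_apply 2 ℝ (Sum.inr i : Fin m ⊕ Fin k) (1 : ℝ) (Sum.inl j)).trans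
      (by simp : _ = (0 : ℝ))).symm
  · exact (PiLp.single_apply 2 ℝ i (1 : ℝ) j).trans
      ((PiLp.single_apply 2 ℝ (Sum.inr i : Fin m ⊕ Fin k) (1 : ℝ) (Sum.inr j)).trans
        (by simp)).symm

theorem part₁_gradient {φ : EuclideanSpace ℝ (Fin m ⊕ Fin k) → ℝ} (hφ : Differentiable ℝ φ)
    (a : EuclideanSpace ℝ (Fin m)) (b : EuclideanSpace ℝ (Fin k)) :
    part₁ (gradient φ (pair a b)) = gradient (fun y => φ (pair y b)) a := by
  ext i
  have h := (hφ (pair a b)).hasFDerivAt.comp a (hasFDerivAt_pair_left a b)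
  rw [gradient_apply]
  change gradient φ (pair a b) (Sum.inl i) = _
  rw [gradient_apply, ← inlL_single]
  exact (congrArg (fun L => L (EuclideanSpace.single i 1)) h.fderiv).symm

theorem part₂_gradient {φ : EuclideanSpace ℝ (Fin m ⊕ Fin k) → ℝ} (hφ : Differentiable ℝ φ)
    (a : EuclideanSpace ℝ (Fin m)) (b : EuclideanSpace ℝ (Fin k)) :
    part₂ (gradient φ (pair a b)) = gradient (fun y => φ (pair a y)) b := by
  ext i
  have h := (hφ (pair a b)).hasFDerivAt.comp b (hasFDerivAt_pair_right a b)
  rw [gradient_apply]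
  change gradient φ (pair a b) (Sum.inr i) = _
  rw [gradient_apply, ← inrL_single]
  exact (congrArg (fun L => L (EuclideanSpace.single i 1)) h.fderiv).symm

theorem measurePreserving_pair :
    MeasurePreserving (fun z : EuclideanSpace ℝ (Fin m) × EuclideanSpace ℝ (Fin k) =>
      pair z.1 z.2) :=
  (PiLp.volume_preserving_toLp (Fin m ⊕ Fin k)).comp
    ((volume_measurePreserving_sumPiEquivProdPi_symm fun _ : Fin m ⊕ Fin k => ℝ).comp
      ((PiLp.volume_preserving_ofLp (Fin m)).prod (PiLp.volume_preserving_ofLp (Fin k))))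

theorem measurableEmbedding_pair :
    MeasurableEmbedding (fun z : EuclideanSpace ℝ (Fin m) × EuclideanSpace ℝ (Fin k) =>
      pair z.1 z.2) :=
  (EuclideanSpace.sumEquivProd (𝕜 := ℝ) (ι := Fin m)
    (κ := Fin k)).symm.toHomeomorph.measurableEmbedding

theorem integral_pair (f : EuclideanSpace ℝ (Fin m ⊕ Fin k) → ℝ) :
    ∫ x, f x = ∫ z : EuclideanSpace ℝ (Fin m) × EuclideanSpace ℝ (Fin k), f (pair z.1 z.2) :=
  (measurePreserving_pair.integral_comp measurableEmbedding_pair f).symm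

theorem integrable_pair {f : EuclideanSpace ℝ (Fin m ⊕ Fin k) → ℝ} (hf : Integrable f) :
    Integrable fun z : EuclideanSpace ℝ (Fin m) × EuclideanSpace ℝ (Fin k) => f (pair z.1 z.2) :=
  (measurePreserving_pair.integrable_comp_emb measurableEmbedding_pair).2 hf

variable {ω₁ : Set (EuclideanSpace ℝ (Fin m))} {ω₂ : Set (EuclideanSpace ℝ (Fin k))} {ℓ : ℝ}

theorem isOpen_cylinder (h₁ : IsOpen ω₁) (h₂ : IsOpen ω₂) (hℓ : 0 < ℓ) :
    IsOpen (cylinder ω₁ ω₂ ℓ) :=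
  ((h₁.smul₀ hℓ.ne').preimage continuous_part₁).inter (h₂.preimage continuous_part₂)

theorem cylinder_nonempty (h₁ : (0 : EuclideanSpace ℝ (Fin m)) ∈ ω₁) (h₂ : ω₂.Nonempty) :
    (cylinder ω₁ ω₂ ℓ).Nonempty := by
  obtain ⟨b, hb⟩ := h₂
  refine ⟨pair 0 b, ?_, hb⟩
  rw [part₁_pair]
  exact ⟨0, h₁, smul_zero ℓ⟩

/-- The projection of the compact support of φ is compact, hence closed, and lies in ω₂; it
therefore contains the support of every slice. -/
theorem IsTestFunction.slice {φ : EuclideanSpace ℝ (Fin m ⊕ Fin k) → ℝ}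
    (hφ : IsTestFunction (cylinder ω₁ ω₂ ℓ) φ) (a : EuclideanSpace ℝ (Fin m)) :
    IsTestFunction ω₂ fun b => φ (pair a b) := by
  have hsub : tsupport (fun b => φ (pair a b)) ⊆ part₂ '' tsupport φ := by
    refine closure_minimal (fun b hb => ⟨pair a b, subset_tsupport _ hb, part₂_pair a b⟩) ?_
    exact (hφ.compact.isCompact.image continuous_part₂).isClosed
  refine ⟨hφ.smooth.comp (contDiff_pair.comp (contDiff_const.prodMk contDiff_id)),
    (hφ.compact.isCompact.image continuous_part₂).of_isClosed_subset (isClosed_tsupport _) hsub,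
    hsub.trans ?_⟩
  rintro _ ⟨x, hx, rfl⟩
  exact (hφ.subset hx).2

theorem IsTestFunction.tensor {s : Set (EuclideanSpace ℝ (Fin m))}
    {u : EuclideanSpace ℝ (Fin m) → ℝ} {w : EuclideanSpace ℝ (Fin k) → ℝ}
    (hu : IsTestFunction s u) (hw : IsTestFunction ω₂ w) :
    IsTestFunction {x | part₁ x ∈ s ∧ part₂ x ∈ ω₂} fun x => u (part₁ x) * w (part₂ x) := by
  set K : Set (EuclideanSpace ℝ (Fin m ⊕ Fin k)) :=
    (fun z : EuclideanSpace ℝ (Fin m) × EuclideanSpace ℝ (Fin k) => pair z.1 z.2) ''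
      (tsupport u ×ˢ tsupport w)
  have hK : IsCompact K :=
    (hu.compact.isCompact.prod hw.compact.isCompact).image
      (contDiff_pair (n := 0)).continuous
  have hsub : tsupport (fun x => u (part₁ x) * w (part₂ x)) ⊆ K := by
    refine closure_minimal (fun x hx => ?_) hK.isClosed
    have hx : u (part₁ x) * w (part₂ x) ≠ 0 := hx
    exact ⟨(part₁ x, part₂ x), ⟨subset_tsupport _ (left_ne_zero_of_mul hx),
      subset_tsupport _ (right_ne_zero_of_mul hx)⟩, pair_part x⟩
  refine ⟨(hu.smooth.comp contDiff_part₁).mul (hw.smooth.comp contDiff_part₂),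
    hK.of_isClosed_subset (isClosed_tsupport _) hsub, hsub.trans ?_⟩
  rintro _ ⟨z, hz, rfl⟩
  exact ⟨hu.subset hz.1, hw.subset hz.2⟩

end Product

/-! ### Dilations of test functions. -/

section Scaling

variable {ι : Type*} [Fintype ι] {Ω : Set (EuclideanSpace ℝ ι)} {φ : EuclideanSpace ℝ ι → ℝ}

theorem IsTestFunction.comp_inv_smul (hφ : IsTestFunction Ω φ) {ℓ : ℝ} (hℓ : 0 < ℓ) :
    IsTestFunction (ℓ • Ω) fun x => φ (ℓ⁻¹ • x) where
  smooth := hφ.smooth.comp (contDiff_const_smul _)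
  compact := hφ.compact.comp_homeomorph (Homeomorph.smulOfNeZero ℓ⁻¹ (inv_ne_zero hℓ.ne'))
  subset := fun _ hx => (Set.mem_smul_set_iff_inv_smul_mem₀ hℓ.ne' _ _).2
    (hφ.subset (tsupport_comp_subset_preimage φ (continuous_const_smul ℓ⁻¹) hx))

theorem gradient_const_mul (hφ : Differentiable ℝ φ) (c : ℝ) (x : EuclideanSpace ℝ ι) :
    gradient (fun y => c * φ y) x = c • gradient φ x := by
  classical
  ext i
  simp only [gradient_apply, PiLp.smul_apply]
  rw [fderiv_const_mul (hφ x)]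
  rfl

theorem gradient_comp_smul (hφ : Differentiable ℝ φ) (c : ℝ) (x : EuclideanSpace ℝ ι) :
    gradient (fun y => φ (c • y)) x = c • gradient φ (c • x) := by
  classical
  ext i
  simp only [gradient_apply, PiLp.smul_apply]
  have h := (hφ (c • x)).hasFDerivAt.comp x ((hasFDerivAt_id x).const_smul c)
  refine (congrArg (fun L => L (EuclideanSpace.single i 1)) h.fderiv).trans ?_
  simp

end Scaling

/-! ### Properties of G inherited from `Htilde`, and the two power comparisons. -/

section Integrand

variable {m k : ℕ} {θ₁ θ₂ p q : ℝ} {F : EuclideanSpace ℝ (Fin m) → ℝ}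
  {G : EuclideanSpace ℝ (Fin k) → ℝ}

theorem Admissible.F_nonneg (h : Admissible θ₁ θ₂ q F G) (hθ : 0 < θ₁)
    (Z : EuclideanSpace ℝ (Fin m)) : 0 ≤ F Z :=
  le_trans (by positivity) (h.F_bounds Z).1

theorem Admissible.G_nonneg (h : Admissible θ₁ θ₂ q F G) (hθ : 0 < θ₁)
    (Z : EuclideanSpace ℝ (Fin k)) : 0 ≤ G Z :=
  le_trans (by positivity) (h.G_bounds Z).1

theorem Admissible.Htilde_zeroPair (h : Admissible θ₁ θ₂ q F G) (hθ : 0 < θ₁)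
    (Z : EuclideanSpace ℝ (Fin k)) : Htilde q F G (zeroPair m Z) = G Z := by
  have hq : 0 < q := zero_lt_one.trans h.one_lt
  have hF : F 0 = 0 := le_antisymm (by simpa using (h.F_bounds 0).2) (h.F_nonneg hθ 0)
  rw [Htilde, part₁_zeroPair, part₂_zeroPair, hF, Real.zero_rpow hq.ne', zero_add, one_div,
    Real.rpow_rpow_inv (h.G_nonneg hθ Z) hq.ne']

theorem Admissible.muInf_eq (h : Admissible θ₁ θ₂ q F G) (hθ : 0 < θ₁)
    (ω₂ : Set (EuclideanSpace ℝ (Fin k))) :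
    muInf p (Htilde q F G) ω₂ = firstEigenvalue p G ω₂ := by
  rw [muInf, funext (h.Htilde_zeroPair hθ)]

/-- G is assumed only to satisfy two-sided bounds; its regularity comes from being the restriction
of `Htilde` to a subspace. -/
theorem Admissible.exists_lipschitzWith_G (h : Admissible θ₁ θ₂ q F G) (hθ : 0 < θ₁) :
    ∃ K : NNReal, LipschitzWith K G := by
  obtain ⟨K, hK⟩ := h.finsler.exists_lipschitzWith
  refine ⟨K * ‖inrL m k‖₊, ?_⟩
  rw [← funext (h.Htilde_zeroPair hθ)]
  exact hK.comp (inrL m k).lipschitz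

theorem Admissible.G_smul (h : Admissible θ₁ θ₂ q F G) (hθ : 0 < θ₁) (c : ℝ)
    (Z : EuclideanSpace ℝ (Fin k)) : G (c • Z) = |c| * G Z := by
  rw [← h.Htilde_zeroPair hθ, ← h.Htilde_zeroPair hθ, ← h.finsler.homogeneous, ← inrL_apply,
    ← inrL_apply, map_smul]

theorem Admissible.G_zero (h : Admissible θ₁ θ₂ q F G) (hθ : 0 < θ₁) : G 0 = 0 := by
  simpa using h.G_smul hθ 0 0

/-- The ℓ^q norm of the pair (F, G) decreases in q; the p-th power is then taken. -/
theorem Admissible.add_le_Htilde_rpow (h : Admissible θ₁ θ₂ q F G) (hθ : 0 < θ₁) (hqp : q ≤ p)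
    (z : EuclideanSpace ℝ (Fin m ⊕ Fin k)) :
    F (part₁ z) ^ p + G (part₂ z) ^ p ≤ Htilde q F G z ^ p := by
  have hq : 0 < q := zero_lt_one.trans h.one_lt
  have hp : 0 < p := hq.trans_le hqp
  have hF := h.F_nonneg hθ (part₁ z)
  have hG := h.G_nonneg hθ (part₂ z)
  have := Real.rpow_le_rpow (by positivity) (Real.rpow_add_rpow_le hF hG hq hqp) hp.le
  rwa [one_div, Real.rpow_inv_rpow (by positivity) hp.ne'] at this

theorem Admissible.Htilde_rpow_le_add (h : Admissible θ₁ θ₂ q F G) (hθ : 0 < θ₁) (hp : 0 < p)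
    (hpq : p ≤ q) (z : EuclideanSpace ℝ (Fin m ⊕ Fin k)) :
    Htilde q F G z ^ p ≤ F (part₁ z) ^ p + G (part₂ z) ^ p := by
  have hF := h.F_nonneg hθ (part₁ z)
  have hG := h.G_nonneg hθ (part₂ z)
  have := Real.rpow_le_rpow (by positivity) (Real.rpow_add_rpow_le hF hG hp hpq) hp.le
  rwa [one_div p, Real.rpow_inv_rpow (by positivity) hp.ne'] at this

end Integrand

/-! ### The two eigenvalue bounds. -/

section Comparison

variable {m k : ℕ} {θ₁ θ₂ p q ℓ : ℝ} {F : EuclideanSpace ℝ (Fin m) → ℝ}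
  {G : EuclideanSpace ℝ (Fin k) → ℝ} {ω₁ : Set (EuclideanSpace ℝ (Fin m))}
  {ω₂ : Set (EuclideanSpace ℝ (Fin k))}

/-- The energy in the directions of `ω₂` is controlled slice by slice. -/
theorem IsTestFunction.firstEigenvalue_mul_le_slice {φ : EuclideanSpace ℝ (Fin m ⊕ Fin k) → ℝ}
    (hφ : IsTestFunction (cylinder ω₁ ω₂ ℓ) φ) (hp : 0 < p) (hG : ∀ Z, 0 ≤ G Z)
    (hGc : Continuous G) (hG0 : G 0 = 0) :
    firstEigenvalue p G ω₂ * ∫ x, |φ x| ^ p ≤ ∫ x, G (part₂ (gradient φ x)) ^ p := by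
  have hint : Integrable fun x => G (part₂ (gradient φ x)) ^ p :=
    hφ.integrable_energy hp (hGc.comp continuous_part₂)
      (show G (part₂L m k 0) = 0 by rw [_root_.map_zero, hG0])
  have hI := integrable_pair (hφ.integrable_abs_rpow hp)
  have hJ := integrable_pair hint
  rw [integral_pair, integral_pair, Measure.volume_eq_prod, integral_prod _ hI,
    integral_prod _ hJ, ← integral_const_mul]
  refine integral_mono (hI.integral_prod_left.const_mul _) hJ.integral_prod_left fun a => ?_
  simp only [part₂_gradient hφ.differentiable]
  exact (hφ.slice a).firstEigenvalue_mul_le hp hG hG0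

theorem Admissible.add_muInf_le_lambda₁ (h : Admissible θ₁ θ₂ q F G) (hθ : 0 < θ₁) (hp : 1 < p)
    (hqp : q ≤ p) (h₁ : IsOpen ω₁) (h₁0 : (0 : EuclideanSpace ℝ (Fin m)) ∈ ω₁)
    (h₂ : IsOpen ω₂) (h₂n : ω₂.Nonempty) (i : Fin m) {R : ℝ} (hR0 : 0 < R)
    (hR : ∀ x ∈ ω₁, ‖x‖ ≤ R) (hℓ : 0 < ℓ) :
    θ₁ ^ p / (p * R) ^ p / ℓ ^ p + muInf p (Htilde q F G) ω₂ ≤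
      lambda₁ p (Htilde q F G) ω₁ ω₂ ℓ := by
  have hp0 : 0 < p := by linarith
  obtain ⟨K, hK⟩ := h.finsler.exists_lipschitzWith
  obtain ⟨K', hK'⟩ := h.exists_lipschitzWith_G hθ
  rw [h.muInf_eq hθ]
  refine le_firstEigenvalue hp (isOpen_cylinder h₁ h₂ hℓ) (cylinder_nonempty h₁0 h₂n)
    h.finsler.nonneg hK h.finsler.map_zero fun φ hφ => ?_
  -- Poincaré in a direction of ω₁: its constant grows like ℓ^p, which produces the gain of order
  -- ℓ^(-p).
  have hP := hφ.integral_abs_rpow_le hp (Sum.inl i) (R := R * ℓ) (by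
    rintro x ⟨⟨y, hy, hxy⟩, -⟩
    have e : x (Sum.inl i) = ℓ * y i := by
      change part₁ x i = _
      rw [← hxy]
      rfl
    rw [e, abs_mul, abs_of_pos hℓ, mul_comm R]
    gcongr
    exact (PiLp.norm_apply_le y i).trans (hR y hy))
  rw [← mul_assoc, Real.mul_rpow (by positivity) hℓ.le] at hP
  have hS := hφ.firstEigenvalue_mul_le_slice hp0 (h.G_nonneg hθ) hK'.continuous (h.G_zero hθ)
  have hI₁ : Integrable fun x => |gradient φ x (Sum.inl i)| ^ p :=
    hφ.integrable_energy (N := fun z => |z (Sum.inl i)|) hp0 (by fun_prop) (by simp)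
  have hI₂ : Integrable fun x => G (part₂ (gradient φ x)) ^ p :=
    hφ.integrable_energy hp0 (hK'.continuous.comp continuous_part₂)
      (show G (part₂L m k 0) = 0 by rw [_root_.map_zero, h.G_zero hθ])
  have hle : θ₁ ^ p * (∫ x, |gradient φ x (Sum.inl i)| ^ p) + ∫ x, G (part₂ (gradient φ x)) ^ p ≤
      ∫ x, Htilde q F G (gradient φ x) ^ p := by
    rw [← integral_const_mul, ← integral_add (hI₁.const_mul _) hI₂]
    refine integral_mono ((hI₁.const_mul _).add hI₂)
      (hφ.integrable_energy hp0 hK.continuous h.finsler.map_zero) fun x => ?_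
    refine le_trans ?_ (h.add_le_Htilde_rpow hθ hqp _)
    refine add_le_add ?_ le_rfl
    rw [← Real.mul_rpow hθ.le (abs_nonneg _)]
    refine Real.rpow_le_rpow (by positivity) (le_trans ?_ (h.F_bounds _).1) hp0.le
    gcongr
    exact PiLp.norm_apply_le (part₁ (gradient φ x)) i
  have hT : θ₁ ^ p / (p * R) ^ p / ℓ ^ p * ∫ x, |φ x| ^ p ≤
      θ₁ ^ p * ∫ x, |gradient φ x (Sum.inl i)| ^ p := by
    rw [div_div, div_mul_eq_mul_div, mul_div_assoc]
    refine mul_le_mul_of_nonneg_left ?_ (by positivity)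
    rw [div_le_iff₀ (by positivity), mul_comm]
    exact hP
  rw [add_mul]
  linarith

theorem Admissible.lambda₁_le_muInf_add (h : Admissible θ₁ θ₂ q F G) (hθ : 0 < θ₁) (hp : 1 < p)
    (hpq : p ≤ q) (h₂ : IsOpen ω₂) (h₂n : ω₂.Nonempty) {ψ : EuclideanSpace ℝ (Fin m) → ℝ}
    (hψ : IsTestFunction ω₁ ψ) (hψ0 : 0 < ∫ x, |ψ x| ^ p) (hℓ : 0 < ℓ) :
    lambda₁ p (Htilde q F G) ω₁ ω₂ ℓ ≤ muInf p (Htilde q F G) ω₂ +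
      θ₂ ^ p * (∫ x, ‖gradient ψ x‖ ^ p) / (∫ x, |ψ x| ^ p) / ℓ ^ p := by
  have hp0 : 0 < p := by linarith
  obtain ⟨K, hK⟩ := h.finsler.exists_lipschitzWith
  obtain ⟨K', hK'⟩ := h.exists_lipschitzWith_G hθ
  rw [h.muInf_eq hθ, ← sub_le_iff_le_add]
  -- With the ℓ^(-p) term moved to the left, the claim bounds `muInf` from below, so an arbitrary
  -- test function w replaces a minimizer.
  refine le_firstEigenvalue hp h₂ h₂n (h.G_nonneg hθ) hK' (h.G_zero hθ) fun w hw => ?_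
  set u : EuclideanSpace ℝ (Fin m) → ℝ := fun x => ψ (ℓ⁻¹ • x)
  have hu : IsTestFunction (ℓ • ω₁) u := hψ.comp_inv_smul hℓ
  have hv : IsTestFunction (cylinder ω₁ ω₂ ℓ) fun x => u (part₁ x) * w (part₂ x) := hu.tensor hw
  have hlam := hv.firstEigenvalue_mul_le hp0 h.finsler.nonneg h.finsler.map_zero
  have hIv := hv.integrable_energy hp0 hK.continuous h.finsler.map_zero
  have hIu : Integrable fun a => ‖gradient u a‖ ^ p :=
    hu.integrable_energy (N := fun z => ‖z‖) hp0 continuous_norm norm_zero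
  have hIw := hw.integrable_energy hp0 hK'.continuous (h.G_zero hθ)
  have hθ₂ : ∀ a, 0 ≤ θ₂ * ‖gradient u a‖ := fun a =>
    (h.F_nonneg hθ _).trans (h.F_bounds (gradient u a)).2
  have hpt : ∀ z : EuclideanSpace ℝ (Fin m) × EuclideanSpace ℝ (Fin k),
      Htilde q F G (gradient (fun x => u (part₁ x) * w (part₂ x)) (pair z.1 z.2)) ^ p ≤
        θ₂ ^ p * (‖gradient u z.1‖ ^ p * |w z.2| ^ p) +
          |u z.1| ^ p * G (gradient w z.2) ^ p := by
    rintro ⟨a, b⟩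
    refine (h.Htilde_rpow_le_add hθ hp0 hpq _).trans ?_
    rw [part₁_gradient hv.differentiable, part₂_gradient hv.differentiable]
    simp only [part₁_pair, part₂_pair]
    -- In each slice the factor of the frozen variable must stand first to be pulled out as a
    -- constant.
    simp only [fun y => mul_comm (u y) (w b)]
    rw [gradient_const_mul hu.differentiable, gradient_const_mul hw.differentiable, h.G_smul hθ,
      Real.mul_rpow (abs_nonneg _) (h.G_nonneg hθ _)]
    refine add_le_add ?_ le_rfl
    refine (Real.rpow_le_rpow (h.F_nonneg hθ _) (h.F_bounds _).2 hp0.le).trans_eq ?_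
    -- The sign of θ₂ is read off from 0 ≤ F ≤ θ₂|·| at a nonzero vector; when the gradient vanishes
    -- no sign is needed.
    have hθ₂0 : gradient u a = 0 ∨ 0 ≤ θ₂ := by
      rcases eq_or_ne (gradient u a) 0 with h0 | h0
      · exact Or.inl h0
      · exact Or.inr (nonneg_of_mul_nonneg_left (hθ₂ a) (norm_pos_iff.2 h0))
    rcases hθ₂0 with h0 | h0
    · simp [h0, hp0.ne']
    · rw [norm_smul, Real.norm_eq_abs, Real.mul_rpow h0 (by positivity),
        Real.mul_rpow (abs_nonneg _) (norm_nonneg _), mul_comm (|w b| ^ p)]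
  have hI₁ : Integrable fun z : EuclideanSpace ℝ (Fin m) × EuclideanSpace ℝ (Fin k) =>
      θ₂ ^ p * (‖gradient u z.1‖ ^ p * |w z.2| ^ p) :=
    (hIu.mul_prod (hw.integrable_abs_rpow hp0)).const_mul _
  have hI₂ : Integrable fun z : EuclideanSpace ℝ (Fin m) × EuclideanSpace ℝ (Fin k) =>
      |u z.1| ^ p * G (gradient w z.2) ^ p :=
    (hu.integrable_abs_rpow hp0).mul_prod hIw
  have hup := integral_mono (integrable_pair hIv) (hI₁.add hI₂) hpt
  rw [← integral_pair (fun x => Htilde q F G (gradient (fun x => u (part₁ x) * w (part₂ x)) x) ^ p)]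
    at hup
  simp only [Pi.add_apply] at hup
  rw [integral_add hI₁ hI₂, integral_const_mul, Measure.volume_eq_prod,
    integral_prod_mul (fun a => ‖gradient u a‖ ^ p) (fun b => |w b| ^ p),
    integral_prod_mul (fun a => |u a| ^ p) (fun b => G (gradient w b) ^ p)] at hup
  have hmass : ∫ x, |u (part₁ x) * w (part₂ x)| ^ p = (∫ a, |u a| ^ p) * ∫ b, |w b| ^ p := by
    rw [integral_pair, Measure.volume_eq_prod, ← integral_prod_mul]
    refine integral_congr_ae (ae_of_all _ fun z => ?_)
    simp only [part₁_pair, part₂_pair, abs_mul]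
    exact Real.mul_rpow (abs_nonneg _) (abs_nonneg _)
  -- The Jacobian ℓ^m appears in mass and energy alike and cancels, leaving only ℓ^(-p) from the
  -- gradient.
  have hscale : ∀ f : EuclideanSpace ℝ (Fin m) → ℝ, ∫ a, f (ℓ⁻¹ • a) = ℓ ^ m * ∫ a, f a := by
    intro f
    rw [Measure.integral_comp_inv_smul_of_nonneg _ f hℓ.le]
    simp
  have hu₁ : ∫ a, |u a| ^ p = ℓ ^ m * ∫ a, |ψ a| ^ p := hscale fun a => |ψ a| ^ p
  have hu₂ : ∫ a, ‖gradient u a‖ ^ p = ℓ ^ m * ((∫ a, ‖gradient ψ a‖ ^ p) / ℓ ^ p) := by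
    have e : ∀ a, ‖gradient u a‖ ^ p = ‖gradient ψ (ℓ⁻¹ • a)‖ ^ p / ℓ ^ p := by
      intro a
      rw [gradient_comp_smul hψ.differentiable, norm_smul, Real.norm_eq_abs,
        abs_of_pos (inv_pos.2 hℓ), ← div_eq_inv_mul, Real.div_rpow (norm_nonneg _) hℓ.le]
    simp only [e]
    rw [hscale fun a => ‖gradient ψ a‖ ^ p / ℓ ^ p, integral_div]
  rw [hmass] at hlam
  rw [hu₂, hu₁] at hup
  rw [hu₁] at hlam
  set A := ∫ a, |ψ a| ^ p
  set B := ∫ a, ‖gradient ψ a‖ ^ p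
  set W := ∫ b, |w b| ^ p
  have hℓm : 0 < ℓ ^ m * A := by positivity
  refine le_of_mul_le_mul_left ?_ hℓm
  have e : ℓ ^ m * A * ((lambda₁ p (Htilde q F G) ω₁ ω₂ ℓ - θ₂ ^ p * B / A / ℓ ^ p) * W) =
      lambda₁ p (Htilde q F G) ω₁ ω₂ ℓ * (ℓ ^ m * A * W) -
        θ₂ ^ p * (ℓ ^ m * (B / ℓ ^ p) * W) := by
    have : ℓ ^ p ≠ 0 := (Real.rpow_pos_of_pos hℓ p).ne'
    field_simp
  rw [e, sub_le_iff_le_add']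
  exact hlam.trans hup

end Comparison

end FinslerCylinder

theorem theorem5 (m : ℕ) (hm : 1 ≤ m) (p : ℝ) (hp : 1 < p)
    (ω₁ : Set (EuclideanSpace ℝ (Fin m))) (hω₁_open : IsOpen ω₁)
    (hω₁_bdd : Bornology.IsBounded ω₁) (hω₁_convex : Convex ℝ ω₁) (hω₁_zero : 0 ∈ ω₁) :
    (∀ θ₁ : ℝ, 0 < θ₁ → ∃ C₁ : ℝ, 0 < C₁ ∧
      ∀ (k : ℕ) (_ : 1 ≤ k) (ω₂ : Set (EuclideanSpace ℝ (Fin k))) (_ : IsOpen ω₂)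
        (_ : Bornology.IsBounded ω₂) (_ : ω₂.Nonempty) (θ₂ q : ℝ)
        (F : EuclideanSpace ℝ (Fin m) → ℝ) (G : EuclideanSpace ℝ (Fin k) → ℝ),
        FinslerCylinder.Admissible θ₁ θ₂ q F G → q ≤ p → ∀ ℓ : ℝ, 0 < ℓ →
          C₁ / ℓ ^ p + FinslerCylinder.muInf p (FinslerCylinder.Htilde q F G) ω₂ ≤
            FinslerCylinder.lambda₁ p (FinslerCylinder.Htilde q F G) ω₁ ω₂ ℓ) ∧
    (∀ θ₂ : ℝ, 0 < θ₂ → ∃ C₂ : ℝ, 0 < C₂ ∧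
      ∀ (k : ℕ) (_ : 1 ≤ k) (ω₂ : Set (EuclideanSpace ℝ (Fin k))) (_ : IsOpen ω₂)
        (_ : Bornology.IsBounded ω₂) (_ : ω₂.Nonempty) (θ₁ q : ℝ) (_ : 0 < θ₁)
        (F : EuclideanSpace ℝ (Fin m) → ℝ) (G : EuclideanSpace ℝ (Fin k) → ℝ),
        FinslerCylinder.Admissible θ₁ θ₂ q F G → p ≤ q → ∀ ℓ : ℝ, 0 < ℓ →
          FinslerCylinder.lambda₁ p (FinslerCylinder.Htilde q F G) ω₁ ω₂ ℓ ≤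
            FinslerCylinder.muInf p (FinslerCylinder.Htilde q F G) ω₂ + C₂ / ℓ ^ p) := by
  have hp0 : 0 < p := by linarith
  refine ⟨fun θ₁ hθ₁ => ?_, fun θ₂ hθ₂ => ?_⟩
  · obtain ⟨R, hR0, hR⟩ := hω₁_bdd.exists_pos_norm_le
    -- R depends on ω₁ alone and is chosen before k, ω₂, θ₂, q, F, G and ℓ.
    refine ⟨θ₁ ^ p / (p * R) ^ p, by positivity, ?_⟩
    intro k _ ω₂ h₂ _ h₂n θ₂ q F G h hqp ℓ hℓ
    exact h.add_muInf_le_lambda₁ hθ₁ hp hqp hω₁_open hω₁_zero h₂ h₂n ⟨0, hm⟩ hR0 hR hℓ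
  · obtain ⟨ψ, hψ, hψ0⟩ :=
      FinslerCylinder.exists_isTestFunction_integral_pos hω₁_open ⟨0, hω₁_zero⟩ hp0
    -- Needed only for C₂ > 0: by Poincaré on the bounded set ω₁, a bump with nonzero mass has
    -- nonzero energy.
    have hB : 0 < ∫ x, ‖gradient ψ x‖ ^ p := by
      obtain ⟨R, hR0, hR⟩ := hω₁_bdd.exists_pos_norm_le
      have hP := hψ.integral_abs_rpow_le hp ⟨0, hm⟩ (R := R)
        fun x hx => (PiLp.norm_apply_le x _).trans (hR x hx)
      have hle : ∫ x, |gradient ψ x ⟨0, hm⟩| ^ p ≤ ∫ x, ‖gradient ψ x‖ ^ p :=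
        integral_mono
          (hψ.integrable_energy (N := fun z => |z ⟨0, hm⟩|) hp0 (by fun_prop) (by simp))
          (hψ.integrable_energy (N := fun z => ‖z‖) hp0 continuous_norm norm_zero)
          fun x => Real.rpow_le_rpow (abs_nonneg _) (PiLp.norm_apply_le (gradient ψ x) _) hp0.le
      exact (pos_of_mul_pos_right (hψ0.trans_le hP) (by positivity)).trans_le hle
    refine ⟨θ₂ ^ p * (∫ x, ‖gradient ψ x‖ ^ p) / ∫ x, |ψ x| ^ p, by positivity, ?_⟩
    intro k _ ω₂ h₂ _ h₂n θ₁ q hθ₁ F G h hpq ℓ hℓ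
    exact h.lambda₁_le_muInf_add hθ₁ hp hpq h₂ h₂n hψ hψ0 hℓ
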